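/- Let $k$ be a field of characteristic zero, let $n\ge 4$ and $d\ge 3$ be integers, and let $R=k[x_1,\dots,x_n]$ with the standard grading. Let $\mathrm{RLex}(x_1x_2^{d-1})$ be the ideal of $R$ generated by all monomials of degree $d$ that are greater than or equal to $x_1x_2^{d-1}$ in the reverse lexicographic order with $x_1>\cdots>x_n$ (for monomials of the same degree, $x^a>x^b$ if the last non-zero entry of $a-b$ is negative), and put \[ I=(x_1^d,\dots,x_n^d)+\mathrm{RLex}(x_1x_2^{d-1}). \] Then \[ I=(x_1,x_2)^d+(x_3^d,\dots,x_n^d), \] and the algebra $A=R/I$ does not have the weak Lefschetz property. That is, there is no linear form $\ell\in A_1$ such that for every $j\ge 0$ the multiplication map $\cdot\ell:A_j\to A_{j+1}$ has full rank, i.e. rank equal to $\min\{\dim_k A_j,\dim_k A_{j+1}\}$. -/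

import Mathlib

/-!
Number the variables `x₀, …, x_{n-1}`, so that `A = k[x₀, x₁]/(x₀, x₁)ᵈ ⊗ C` with
`C = k[x₂, …, x_{n-1}]/(xᵢᵈ)`, and compare `A` with `B = k[y]/(yᵈ) ⊗ C`. Both `B` and `C` are
monomial complete intersections, whose Hilbert functions increase strictly up to the middle degree
and then decrease strictly.

Write a linear form as `ℓ = ℓ₁ + ℓ₂` with `ℓ₁` in the span of `x₀, x₁` and `ℓ₂` free of both. If
`ℓ₁ = s y` for a linear form `y ≠ 0` in `x₀, x₁`, then `B` is a subalgebra of `A` containing `ℓ`, so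
injectivity of `ℓ` on `A_j` forces `dim B_j ≤ dim B_{j+1}`. Substituting `(x₀, x₁) ↦ (p₀ y, p₁ y)`
for a nontrivial zero `p` of `ℓ₁` maps `A` onto `B` and `ℓ` to `ℓ₂`. Since `B` is free over `C` on
`1, y, …, y^{d-1}`, surjectivity of `ℓ` on `A_{e+d-1}` forces `dim C_{e+1} ≤ dim C_e`. As `n ≥ 4`
and `d ≥ 3`, there is an `e` with `e + 1` at most the middle degree of `C` and `e + d - 1` at least
that of `B`, and then `ℓ` is neither injective nor surjective on `A_{e+d-1}`.
-/

/-- For an ideal `I` of `R = k[x_1, …, x_n]`, the degree `j` part `A_j` of `A = R/I`: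
the image in `A` of the homogeneous polynomials of degree `j`. -/
noncomputable def gradedPart {k : Type*} [Field k] {n : ℕ} (I : Ideal (MvPolynomial (Fin n) k))
    (j : ℕ) : Submodule k (MvPolynomial (Fin n) k ⧸ I) :=
  (MvPolynomial.homogeneousSubmodule (Fin n) k j).map (Ideal.Quotient.mkₐ k I).toLinearMap

theorem mul_mem_gradedPart {k : Type*} [Field k] {n : ℕ} (I : Ideal (MvPolynomial (Fin n) k))
    {i j : ℕ} {a b : MvPolynomial (Fin n) k ⧸ I} (ha : a ∈ gradedPart I i)
    (hb : b ∈ gradedPart I j) : a * b ∈ gradedPart I (j + i) := by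
  obtain ⟨p, hp, rfl⟩ := ha
  obtain ⟨q, hq, rfl⟩ := hb
  refine ⟨p * q, ?_, by simp⟩
  rw [add_comm]
  exact MvPolynomial.IsHomogeneous.mul hp hq

/-- Multiplication by `ℓ ∈ A_1`, as a `k`-linear map `A_j → A_{j+1}`. -/
noncomputable def mulLinearForm {k : Type*} [Field k] {n : ℕ}
    (I : Ideal (MvPolynomial (Fin n) k)) (l : gradedPart I 1) (j : ℕ) :
    gradedPart I j →ₗ[k] gradedPart I (j + 1) :=
  (LinearMap.mulLeft k (l : MvPolynomial (Fin n) k ⧸ I)).restrict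
    (fun _ hx => mul_mem_gradedPart I l.2 hx)

/-- A linear map between finite-dimensional vector spaces has full rank if its rank is the
minimum of the two dimensions. -/
def HasFullRank {k V W : Type*} [Field k] [AddCommGroup V] [Module k V] [AddCommGroup W]
    [Module k W] (f : V →ₗ[k] W) : Prop :=
  Module.finrank k (LinearMap.range f) = min (Module.finrank k V) (Module.finrank k W)

/-- The weak Lefschetz property of the standard graded algebra `A = k[x_1, …, x_n]/I`
(for a homogeneous ideal `I`): for some linear form `ℓ ∈ A_1`, all the maps
`ℓ · : A_j → A_{j+1}`, `j ≥ 0`, have full rank. -/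
def HasWLP {k : Type*} [Field k] {n : ℕ} (I : Ideal (MvPolynomial (Fin n) k)) : Prop :=
  ∃ l : gradedPart I 1, ∀ j : ℕ, HasFullRank (mulLinearForm I l j)

/-- The reverse lexicographic order with `x_1 > ⋯ > x_n` on monomials of the same degree, in terms
of exponent vectors: `x^a > x^b` if the last non-zero entry of `a - b` is negative. -/
def RevLexGT {n : ℕ} (a b : Fin n →₀ ℕ) : Prop :=
  a.degree = b.degree ∧ ∃ i : Fin n, a i < b i ∧ ∀ j : Fin n, i < j → a j = b j

/-- `RLex(x^m)`: the ideal generated by all monomials of the same degree as `x^m` that are greater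
than or equal to `x^m` in the reverse lexicographic order. -/
noncomputable def RLex (k : Type*) [Field k] {n : ℕ} (m : Fin n →₀ ℕ) :
    Ideal (MvPolynomial (Fin n) k) :=
  Ideal.span {f | ∃ a : Fin n →₀ ℕ, (a = m ∨ RevLexGT a m) ∧ f = MvPolynomial.monomial a 1}

/-- The number of lattice points of the cube `[0, d - 1]ʳ` with coordinate sum `z`, i.e. the Hilbert
function of `k[x_1, …, x_r]/(x_1^d, …, x_r^d)` in degree `z`. Integer arguments make the symmetry
about `r (d - 1) / 2` free of truncated subtraction. -/
def boxCount (d r : ℕ) (z : ℤ) : ℕ :=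
  Fintype.card {a : Fin r → Fin d // ∑ i, ((a i : ℕ) : ℤ) = z}

section BoxCount

theorem boxCount_zero (d : ℕ) (z : ℤ) : boxCount d 0 z = if z = 0 then 1 else 0 := by
  rw [boxCount, Fintype.card_subtype]
  split_ifs with h
  · simp [h]
  · simp [Ne.symm h]

theorem boxCount_of_neg (d r : ℕ) {z : ℤ} (hz : z < 0) : boxCount d r z = 0 := by
  refine Fintype.card_eq_zero_iff.2 ⟨fun a => hz.not_ge ?_⟩
  rw [← a.2]
  positivity

theorem boxCount_succ (d r : ℕ) (z : ℤ) :
    boxCount d (r + 1) z = ∑ c ∈ Finset.range d, boxCount d r (z - c) := by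
  rw [← Fin.sum_univ_eq_sum_range (fun c => boxCount d r (z - c)) d]
  simp only [boxCount]
  rw [← Fintype.card_sigma]
  refine Fintype.card_congr
    { toFun a := ⟨a.1 0, fun i => a.1 i.succ, ?_⟩
      invFun b := ⟨Fin.cons b.1 b.2.1, ?_⟩
      left_inv a := Subtype.ext (Fin.cons_self_tail a.1)
      right_inv _ := rfl }
  · exact eq_sub_of_add_eq' ((Fin.sum_univ_succ _).symm.trans a.2)
  · simp only [Fin.sum_univ_succ, Fin.cons_zero, Fin.cons_succ, b.2.2, add_sub_cancel]

theorem boxCount_one (d : ℕ) (z : ℤ) : boxCount d 1 z = if 0 ≤ z ∧ z < d then 1 else 0 := by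
  simp only [boxCount_succ, boxCount_zero, sub_eq_zero]
  split_ifs with h
  · lift z to ℕ using h.1
    simpa using h
  · refine Finset.sum_eq_zero fun c hc => if_neg ?_
    have := Finset.mem_range.1 hc
    omega

theorem boxCount_reflect (d r : ℕ) (z : ℤ) :
    boxCount d r (r * ((d : ℤ) - 1) - z) = boxCount d r z := by
  have sum_rev (a : Fin r → Fin d) :
      ∑ i, (((a i).rev : ℕ) : ℤ) = r * ((d : ℤ) - 1) - ∑ i, ((a i : ℕ) : ℤ) := by
    have val_rev (i : Fin r) : (((a i).rev : ℕ) : ℤ) = ((d : ℤ) - 1) - ((a i : ℕ) : ℤ) := by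
      rw [Fin.val_rev]
      omega
    rw [Finset.sum_congr rfl fun i _ => val_rev i, Finset.sum_sub_distrib]
    simp [mul_sub]
  refine Fintype.card_congr ((Equiv.arrowCongr (.refl _) Fin.revPerm).subtypeEquiv fun a => ?_)
  simp only [Equiv.arrowCongr_apply, Equiv.coe_refl, Function.comp_apply, Fin.revPerm_apply,
    Equiv.refl_symm, id, sum_rev]
  exact ⟨fun h => by linarith, fun h => by linarith⟩

theorem boxCount_succ_add_boxCount_sub (d r : ℕ) (z : ℤ) :
    boxCount d (r + 1) z + boxCount d r (z - d) =
      boxCount d (r + 1) (z - 1) + boxCount d r z := by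
  have shift (c : ℕ) : z - 1 - (c : ℤ) = z - ((c + 1 : ℕ) : ℤ) := by push_cast; ring
  rw [boxCount_succ, boxCount_succ, ← Finset.sum_range_succ fun c : ℕ => boxCount d r (z - c),
    Finset.sum_range_succ']
  simp only [shift, Nat.cast_zero, sub_zero]

theorem boxCount_succ_strictMonoOn {d r : ℕ}
    (h : ∀ z : ℤ, 0 ≤ z → 2 * z ≤ (r + 1) * ((d : ℤ) - 1) →
      boxCount d r (z - d) < boxCount d r z) :
    StrictMonoOn (boxCount d (r + 1)) {z | -1 ≤ z ∧ 2 * z ≤ (r + 1) * ((d : ℤ) - 1)} := by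
  refine strictMonoOn_of_lt_add_one
    ⟨fun x hx y hy z hz => ⟨hx.1.trans hz.1, by linarith [hy.2, hz.2]⟩⟩ fun z _ hz hz' => ?_
  have hlt := h (z + 1) (by linarith [hz.1]) hz'.2
  have hrec := boxCount_succ_add_boxCount_sub d r (z + 1)
  rw [add_sub_cancel_right] at hrec
  omega

theorem boxCount_sub_lt_of_strictMonoOn {d r : ℕ} (hd : 1 ≤ d) (hr : 1 ≤ r)
    (hmono : StrictMonoOn (boxCount d r) {z | -1 ≤ z ∧ 2 * z ≤ r * ((d : ℤ) - 1)})
    {z : ℤ} (hz : 0 ≤ z) (hz' : 2 * z ≤ (r + 1) * ((d : ℤ) - 1)) :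
    boxCount d r (z - d) < boxCount d r z := by
  have lt_of_lt {a b : ℤ} (hab : a < b) (hb : 0 ≤ b) (hb' : 2 * b ≤ r * ((d : ℤ) - 1)) :
      boxCount d r a < boxCount d r b := by
    rcases lt_or_ge a (-1) with ha | ha
    · rw [boxCount_of_neg d r (by omega), ← boxCount_of_neg d r (neg_one_lt_zero)]
      exact hmono ⟨le_rfl, by omega⟩ ⟨by omega, hb'⟩ (by omega)
    · exact hmono ⟨ha, by omega⟩ ⟨by omega, hb'⟩ hab
  rcases le_or_gt (2 * z) (r * ((d : ℤ) - 1)) with hlow | hhigh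
  · exact lt_of_lt (by omega) hz hlow
  · have : (d : ℤ) - 1 ≤ r * ((d : ℤ) - 1) :=
      le_mul_of_one_le_left (by omega) (by exact_mod_cast hr)
    rw [← boxCount_reflect d r z]
    exact lt_of_lt (by linarith) (by linarith) (by linarith)

theorem boxCount_sub_lt {d r : ℕ} (hd : 1 ≤ d) (hr : 1 ≤ r) {z : ℤ} (hz : 0 ≤ z)
    (hz' : 2 * z ≤ (r + 1) * ((d : ℤ) - 1)) : boxCount d r (z - d) < boxCount d r z := by
  induction r, hr using Nat.le_induction generalizing z with
  | base =>
    rw [boxCount_one, boxCount_one, if_neg (by omega), if_pos (by push_cast at hz'; omega)]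
    exact one_pos
  | succ r hr ih =>
    refine boxCount_sub_lt_of_strictMonoOn hd (by omega) ?_ hz hz'
    exact_mod_cast boxCount_succ_strictMonoOn fun z => ih

theorem boxCount_strictMonoOn {d r : ℕ} (hd : 1 ≤ d) (hr : 2 ≤ r) :
    StrictMonoOn (boxCount d r) {z | -1 ≤ z ∧ 2 * z ≤ r * ((d : ℤ) - 1)} := by
  obtain ⟨r, rfl⟩ := Nat.exists_eq_add_of_le' hr
  exact_mod_cast boxCount_succ_strictMonoOn fun z => boxCount_sub_lt hd (by omega)

theorem boxCount_strictAntiOn {d r : ℕ} (hd : 1 ≤ d) (hr : 2 ≤ r) :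
    StrictAntiOn (boxCount d r)
      {z | r * ((d : ℤ) - 1) ≤ 2 * z ∧ z ≤ r * ((d : ℤ) - 1) + 1} := by
  intro a ha b hb hab
  rw [← boxCount_reflect d r a, ← boxCount_reflect d r b]
  exact boxCount_strictMonoOn hd hr ⟨by linarith [hb.2], by linarith [hb.1]⟩
    ⟨by linarith [ha.2], by linarith [ha.1]⟩ (by linarith)

end BoxCount

open MvPolynomial

section MulLinearForm

variable {k : Type*} [Field k] {m n : ℕ}

instance gradedPart.finite (I : Ideal (MvPolynomial (Fin n) k)) (j : ℕ) :
    Module.Finite k (gradedPart I j) :=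
  Module.Finite.iff_fg.2 ((homogeneousSubmodule_fg (R := k) (σ := Fin n) j).map _)

theorem mk_mem_gradedPart (I : Ideal (MvPolynomial (Fin n) k)) {j : ℕ} {f : MvPolynomial (Fin n) k}
    (hf : f.IsHomogeneous j) : Ideal.Quotient.mk I f ∈ gradedPart I j :=
  ⟨f, hf, rfl⟩

theorem HasFullRank.injective_or_surjective {V W : Type*} [AddCommGroup V] [Module k V]
    [AddCommGroup W] [Module k W] [Module.Finite k V] [Module.Finite k W] {f : V →ₗ[k] W}
    (h : HasFullRank f) : Function.Injective f ∨ Function.Surjective f := by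
  unfold HasFullRank at h
  rcases le_total (Module.finrank k V) (Module.finrank k W) with hle | hle
  · left
    rw [min_eq_left hle] at h
    have rank_nullity := f.finrank_range_add_finrank_ker
    rw [← LinearMap.ker_eq_bot, ← Submodule.finrank_eq_zero (R := k)]
    omega
  · right
    rw [min_eq_right hle] at h
    exact LinearMap.range_eq_top.1 (Submodule.eq_top_of_finrank_eq h)

variable {I : Ideal (MvPolynomial (Fin n) k)} {J : Ideal (MvPolynomial (Fin m) k)}

theorem mulLinearForm_injective_iff {L : MvPolynomial (Fin n) k} (hL : L.IsHomogeneous 1) {j : ℕ} :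
    Function.Injective (mulLinearForm I ⟨_, mk_mem_gradedPart I hL⟩ j) ↔
      ∀ f : MvPolynomial (Fin n) k, f.IsHomogeneous j → L * f ∈ I → f ∈ I := by
  rw [← LinearMap.ker_eq_bot, LinearMap.ker_eq_bot']
  simp only [← Ideal.Quotient.eq_zero_iff_mem (I := I), map_mul]
  constructor
  · exact fun h f hf hLf => congrArg Subtype.val (h ⟨_, mk_mem_gradedPart I hf⟩ (Subtype.ext hLf))
  · rintro h ⟨_, f, hf, rfl⟩ hLf
    exact Subtype.ext (h f hf (congrArg Subtype.val hLf))

theorem mulLinearForm_surjective_iff {L : MvPolynomial (Fin n) k} (hL : L.IsHomogeneous 1) {j : ℕ} :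
    Function.Surjective (mulLinearForm I ⟨_, mk_mem_gradedPart I hL⟩ j) ↔
      ∀ g : MvPolynomial (Fin n) k, g.IsHomogeneous (j + 1) →
        ∃ f : MvPolynomial (Fin n) k, f.IsHomogeneous j ∧ L * f - g ∈ I := by
  simp only [← Ideal.Quotient.eq (I := I), map_mul]
  constructor
  · intro h g hg
    obtain ⟨⟨_, f, hf, rfl⟩, hfg⟩ := h ⟨_, mk_mem_gradedPart I hg⟩
    exact ⟨f, hf, congrArg Subtype.val hfg⟩
  · rintro h ⟨_, g, hg, rfl⟩
    obtain ⟨f, hf, hfg⟩ := h g hg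
    exact ⟨⟨_, mk_mem_gradedPart I hf⟩, Subtype.ext hfg⟩

theorem isHomogeneous_algHom_apply {R σ τ : Type*} [CommSemiring R]
    {φ : MvPolynomial σ R →ₐ[R] MvPolynomial τ R} (hφ : ∀ i, (φ (X i)).IsHomogeneous 1)
    {f : MvPolynomial σ R} {j : ℕ} (hf : f.IsHomogeneous j) : (φ f).IsHomogeneous j := by
  rw [aeval_unique φ, ← one_mul j]
  exact hf.aeval _ hφ

theorem homogeneousComponent_algHom_apply {R σ τ : Type*} [CommSemiring R]
    {φ : MvPolynomial σ R →ₐ[R] MvPolynomial τ R} (hφ : ∀ i, (φ (X i)).IsHomogeneous 1)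
    (j : ℕ) (f : MvPolynomial σ R) :
    homogeneousComponent j (φ f) = φ (homogeneousComponent j f) := by
  induction f using MvPolynomial.induction_on' with
  | monomial a c =>
    have hmon : (monomial a c).IsHomogeneous a.degree := isHomogeneous_monomial c rfl
    rw [homogeneousComponent_of_mem hmon,
      homogeneousComponent_of_mem (isHomogeneous_algHom_apply hφ hmon), apply_ite φ, map_zero]
  | add p q hp hq => simp only [map_add, hp, hq]

theorem mulLinearForm_injective_of_comap_eq
    {ψ : MvPolynomial (Fin m) k →ₐ[k] MvPolynomial (Fin n) k}
    (hψ : ∀ i, (ψ (X i)).IsHomogeneous 1) (hIJ : I.comap ψ = J) {L : MvPolynomial (Fin m) k}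
    (hL : L.IsHomogeneous 1) {j : ℕ}
    (h : Function.Injective (mulLinearForm I
      ⟨_, mk_mem_gradedPart I (isHomogeneous_algHom_apply hψ hL)⟩ j)) :
    Function.Injective (mulLinearForm J ⟨_, mk_mem_gradedPart J hL⟩ j) := by
  subst hIJ
  rw [mulLinearForm_injective_iff (isHomogeneous_algHom_apply hψ hL)] at h
  rw [mulLinearForm_injective_iff hL]
  intro f hf hLf
  exact h _ (isHomogeneous_algHom_apply hψ hf) (by rwa [Ideal.mem_comap, map_mul] at hLf)

theorem mulLinearForm_surjective_of_le_comap
    {φ : MvPolynomial (Fin n) k →ₐ[k] MvPolynomial (Fin m) k}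
    (hφ : ∀ i, (φ (X i)).IsHomogeneous 1) (hφsurj : Function.Surjective φ) (hIJ : I ≤ J.comap φ)
    {L : MvPolynomial (Fin n) k} (hL : L.IsHomogeneous 1) {j : ℕ}
    (h : Function.Surjective (mulLinearForm I ⟨_, mk_mem_gradedPart I hL⟩ j)) :
    Function.Surjective (mulLinearForm J
      ⟨_, mk_mem_gradedPart J (isHomogeneous_algHom_apply hφ hL)⟩ j) := by
  rw [mulLinearForm_surjective_iff hL] at h
  rw [mulLinearForm_surjective_iff (isHomogeneous_algHom_apply hφ hL)]
  intro g hg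
  obtain ⟨g, rfl⟩ := hφsurj g
  obtain ⟨f, hf, hfg⟩ := h _ (homogeneousComponent_isHomogeneous (j + 1) g)
  refine ⟨φ f, isHomogeneous_algHom_apply hφ hf, ?_⟩
  rw [← homogeneousComponent_eq_self hg, homogeneousComponent_algHom_apply hφ, ← map_mul, ← map_sub]
  exact hIJ hfg

end MulLinearForm

section PurePowers

/-- The ideal `(x_i^d : i ∈ σ)`, whose quotient is the monomial complete intersection of type
`(d, …, d)`. -/
noncomputable def purePowers (R σ : Type*) [CommSemiring R] (d : ℕ) : Ideal (MvPolynomial σ R) :=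
  Ideal.span (Set.range fun i => X i ^ d)

theorem X_pow_mem_purePowers {R σ : Type*} [CommSemiring R] (d : ℕ) (i : σ) :
    X i ^ d ∈ purePowers R σ d :=
  Ideal.subset_span ⟨i, rfl⟩

theorem mem_purePowers_iff {R σ : Type*} [CommSemiring R] {d : ℕ} {f : MvPolynomial σ R} :
    f ∈ purePowers R σ d ↔ ∀ a : σ →₀ ℕ, (∀ i, a i < d) → coeff a f = 0 := by
  have range_eq : (Set.range fun i : σ => (X i : MvPolynomial σ R) ^ d) =
      (fun a => monomial a 1) '' Set.range fun i => Finsupp.single i d := by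
    rw [← Set.range_comp]
    simp only [X_pow_eq_monomial, Function.comp_def]
  rw [purePowers, range_eq, mem_ideal_span_monomial_image]
  simp only [Set.exists_range_iff, Finsupp.single_le_iff, mem_support_iff]
  refine forall_congr' fun a => ?_
  rw [not_imp_comm]
  simp only [not_exists, not_le]

/-- A point of the cube `[0, d - 1]ʳ`, as the exponent vector of a monomial. -/
noncomputable def boxExponent {d r : ℕ} (a : Fin r → Fin d) : Fin r →₀ ℕ :=
  Finsupp.equivFunOnFinite.symm fun i => a i

theorem boxExponent_injective {d r : ℕ} :
    Function.Injective (boxExponent : (Fin r → Fin d) → Fin r →₀ ℕ) := fun _ _ h =>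
  funext fun i => Fin.ext (DFunLike.congr_fun h i)

theorem degree_boxExponent_eq_iff {d r j : ℕ} (a : Fin r → Fin d) :
    (boxExponent a).degree = j ↔ ∑ i, ((a i : ℕ) : ℤ) = j := by
  rw [Finsupp.degree_eq_sum, ← Nat.cast_sum, Nat.cast_inj]
  rfl

variable {k : Type*} [Field k]

theorem linearIndependent_mk_monomial_boxExponent (d r : ℕ) :
    LinearIndependent k fun a : Fin r → Fin d =>
      Ideal.Quotient.mkₐ k (purePowers k (Fin r) d) (monomial (boxExponent a) 1) := by
  rw [Fintype.linearIndependent_iff]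
  intro c hc a
  simp only [← map_smul, ← map_sum] at hc
  have hmem := mem_purePowers_iff.1 (Ideal.Quotient.eq_zero_iff_mem.1 hc)
  simpa [coeff_sum, coeff_monomial, boxExponent_injective.eq_iff] using
    hmem (boxExponent a) fun i => (a i).2

theorem gradedPart_purePowers_eq_span (d r j : ℕ) :
    gradedPart (purePowers k (Fin r) d) j =
      Submodule.span k (Set.range fun a : {a : Fin r → Fin d // ∑ i, ((a i : ℕ) : ℤ) = j} =>
        Ideal.Quotient.mkₐ k (purePowers k (Fin r) d) (monomial (boxExponent a.1) 1)) := by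
  refine le_antisymm ?_ (Submodule.span_le.2 ?_)
  · rw [gradedPart, homogeneousSubmodule_eq_finsupp_supported,
      AddMonoidAlgebra.supported_eq_span_single, Submodule.map_span_le]
    rintro _ ⟨a, ha, rfl⟩
    change Ideal.Quotient.mkₐ k (purePowers k (Fin r) d) (monomial a 1) ∈ _
    by_cases hbox : ∀ i, a i < d
    · have ha' : boxExponent (fun i => ⟨a i, hbox i⟩) = a := Finsupp.ext fun _ => rfl
      refine Submodule.subset_span ⟨⟨fun i => ⟨a i, hbox i⟩, ?_⟩, ?_⟩
      · rw [← degree_boxExponent_eq_iff, ha']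
        exact ha
      · simp only [ha']
    · have hmem : monomial a (1 : k) ∈ purePowers k (Fin r) d :=
        mem_purePowers_iff.2 fun b hb => by
          rw [coeff_monomial, if_neg (by rintro rfl; exact hbox hb)]
      rw [Ideal.Quotient.mkₐ_eq_mk, Ideal.Quotient.eq_zero_iff_mem.2 hmem]
      exact zero_mem _
  · rintro _ ⟨a, rfl⟩
    exact mk_mem_gradedPart _ (isHomogeneous_monomial _ ((degree_boxExponent_eq_iff _).2 a.2))

theorem finrank_gradedPart_purePowers (d r j : ℕ) :
    Module.finrank k (gradedPart (purePowers k (Fin r) d) j) = boxCount d r j := by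
  rw [gradedPart_purePowers_eq_span]
  exact finrank_span_eq_card
    ((linearIndependent_mk_monomial_boxExponent d r).comp _ Subtype.val_injective)

theorem coeff_finSuccEquiv_mem_purePowers {R : Type*} [CommSemiring R] {d m i : ℕ} (hi : i < d)
    {f : MvPolynomial (Fin (m + 1)) R} (hf : f ∈ purePowers R (Fin (m + 1)) d) :
    (finSuccEquiv R m f).coeff i ∈ purePowers R (Fin m) d := by
  rw [mem_purePowers_iff] at hf ⊢
  intro a ha
  rw [finSuccEquiv_coeff_coeff]
  exact hf _ (Fin.cases (by simpa using hi) fun t => by simpa using ha t)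

theorem finSuccEquiv_rename_succ {R : Type*} [CommSemiring R] {m : ℕ} (g : MvPolynomial (Fin m) R) :
    finSuccEquiv R m (rename Fin.succ g) = Polynomial.C g := by
  induction g using MvPolynomial.induction_on with
  | C a => simp [finSuccEquiv_apply]
  | add p q hp hq => simp [hp, hq]
  | mul_X p i hp => simp [hp, finSuccEquiv_X_succ]

theorem mulLinearForm_surjective_of_rename_succ {d m e t : ℕ} (ht : t < d)
    {L : MvPolynomial (Fin m) k} (hL : L.IsHomogeneous 1)
    (h : Function.Surjective (mulLinearForm (purePowers k (Fin (m + 1)) d)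
      ⟨_, mk_mem_gradedPart _ (hL.rename_isHomogeneous (f := Fin.succ))⟩ (e + t))) :
    Function.Surjective (mulLinearForm (purePowers k (Fin m) d) ⟨_, mk_mem_gradedPart _ hL⟩ e) := by
  rw [mulLinearForm_surjective_iff hL.rename_isHomogeneous] at h
  rw [mulLinearForm_surjective_iff hL]
  intro g hg
  -- `k[x_0, …, x_m]/(x_i^d)` is free over `k[x_1, …, x_m]/(x_i^d)` on `1, x_0, …, x_0^{d-1}`, and a
  -- linear form without `x_0` acts on the coefficient of each `x_0^t` separately.
  obtain ⟨f, hf, hfg⟩ := h (rename Fin.succ g * X 0 ^ t)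
    (add_right_comm e 1 t ▸ hg.rename_isHomogeneous.mul (isHomogeneous_X_pow _ _))
  refine ⟨(finSuccEquiv k m f).coeff t,
    hf.finSuccEquiv_coeff_isHomogeneous _ _ (add_comm t e), ?_⟩
  simpa only [map_sub, map_mul, map_pow, finSuccEquiv_rename_succ, finSuccEquiv_X_zero,
    Polynomial.coeff_sub, Polynomial.coeff_C_mul, Polynomial.coeff_X_pow_self, mul_one] using
    coeff_finSuccEquiv_mem_purePowers ht hfg

end PurePowers

section PairPowIdeal

/-- The ideal `(x_0, x_1)^d + (x_2^d, …, x_{m+1}^d)`, whose quotient is the algebra shown to fail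
the weak Lefschetz property; `m` counts the variables after the first two. -/
noncomputable def pairPowIdeal (R : Type*) [CommSemiring R] (d m : ℕ) :
    Ideal (MvPolynomial (Fin (m + 2)) R) :=
  Ideal.span {X 0, X 1} ^ d + Ideal.span {f | ∃ i : Fin (m + 2), 2 ≤ (i : ℕ) ∧ f = X i ^ d}

theorem span_pair_pow_le_iff {R : Type*} [CommSemiring R] {x y : R} {d : ℕ} {I : Ideal R} :
    Ideal.span {x, y} ^ d ≤ I ↔ ∀ s t : ℕ, s + t = d → x ^ s * y ^ t ∈ I := by
  constructor
  · rintro h s t rfl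
    rw [pow_add] at h
    exact h (Ideal.mul_mem_mul (Ideal.pow_mem_pow (Ideal.subset_span (by simp)) s)
      (Ideal.pow_mem_pow (Ideal.subset_span (by simp)) t))
  · intro h
    rw [Ideal.span_insert, ← Ideal.add_eq_sup, add_pow, Ideal.sum_eq_sup]
    refine Finset.sup_le fun s hs => Ideal.mul_le_left.trans ?_
    rw [Ideal.span_singleton_pow, Ideal.span_singleton_pow,
      Ideal.span_singleton_mul_span_singleton, Ideal.span_singleton_le_iff_mem]
    exact h _ _ (Nat.add_sub_cancel' (Finset.mem_range_succ_iff.1 hs))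

theorem pairPowIdeal_le_iff {R : Type*} [CommSemiring R] {d m : ℕ}
    {I : Ideal (MvPolynomial (Fin (m + 2)) R)} :
    pairPowIdeal R d m ≤ I ↔
      (∀ s t : ℕ, s + t = d → X 0 ^ s * X 1 ^ t ∈ I) ∧ ∀ i : Fin m, X i.succ.succ ^ d ∈ I := by
  rw [pairPowIdeal, Ideal.add_eq_sup, sup_le_iff, span_pair_pow_le_iff, Ideal.span_le]
  refine and_congr_right fun _ => ⟨fun h i => h ⟨i.succ.succ, by simp, rfl⟩, ?_⟩
  rintro h _ ⟨i, hi, rfl⟩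
  obtain ⟨i, rfl⟩ := Fin.exists_succ_eq.2 (show i ≠ 0 by rintro rfl; simp at hi)
  obtain ⟨i, rfl⟩ := Fin.exists_succ_eq.2 (show i ≠ 0 by rintro rfl; simp at hi)
  exact h i

theorem X_pow_mul_X_pow_mem_pairPowIdeal {R : Type*} [CommSemiring R] {d m s t : ℕ}
    (h : s + t = d) : X 0 ^ s * X 1 ^ t ∈ pairPowIdeal R d m :=
  (pairPowIdeal_le_iff.1 le_rfl).1 s t h

theorem X_succ_succ_pow_mem_pairPowIdeal {R : Type*} [CommSemiring R] {d m : ℕ} (i : Fin m) :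
    X i.succ.succ ^ d ∈ pairPowIdeal R d m :=
  (pairPowIdeal_le_iff.1 le_rfl).2 i

theorem eq_single_zero_add_single_one {m : ℕ} {a : Fin (m + 2) →₀ ℕ}
    (h : ∀ i : Fin m, a i.succ.succ = 0) :
    a = Finsupp.single 0 (a 0) + Finsupp.single 1 (a 1) := by
  ext i
  refine Fin.cases ?_ (Fin.cases ?_ fun i => ?_) i
  · simp
  · simp
  · simp [h, Finsupp.single_eq_of_ne (Fin.succ_succ_ne_one i)]

theorem RevLexGT.exists_eq_single_add_single {m d : ℕ} (hd : 1 ≤ d) {a : Fin (m + 2) →₀ ℕ}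
    (h : RevLexGT a (Finsupp.single 0 1 + Finsupp.single 1 (d - 1))) :
    ∃ s t : ℕ, s + 1 + t = d ∧ a = Finsupp.single 0 (s + 1) + Finsupp.single 1 t := by
  obtain ⟨hdeg, i, hlt, heq⟩ := h
  have tail_apply (j : Fin m) :
      (Finsupp.single 0 1 + Finsupp.single 1 (d - 1) : Fin (m + 2) →₀ ℕ) j.succ.succ = 0 := by
    simp [Finsupp.single_eq_of_ne (Fin.succ_succ_ne_one j)]
  have hi : i ≤ 1 := by
    by_contra! hi
    obtain ⟨j, rfl⟩ := Fin.exists_succ_eq.2 (Fin.zero_lt_one.trans hi).ne'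
    obtain ⟨j, rfl⟩ := Fin.exists_succ_eq.2 (show j ≠ 0 by rintro rfl; exact hi.ne' rfl)
    exact Nat.not_lt_zero _ (tail_apply j ▸ hlt)
  have ha : a = Finsupp.single 0 (a 0) + Finsupp.single 1 (a 1) :=
    eq_single_zero_add_single_one fun j =>
      (heq _ (hi.trans_lt (Fin.succ_lt_succ_iff.2 (Fin.succ_pos j)))).trans (tail_apply j)
  have hdeg' : a 0 + a 1 = 1 + (d - 1) := by
    rw [ha] at hdeg
    simpa only [map_add, Finsupp.degree_single] using hdeg
  have hlast : a 1 ≤ d - 1 := by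
    rcases hi.lt_or_eq with hi | rfl
    · simpa using (heq 1 hi).le
    · simpa using hlt.le
  refine ⟨a 0 - 1, a 1, by omega, ?_⟩
  rwa [Nat.sub_add_cancel (by omega)]

theorem eq_or_revLexGT_single_add_single_iff {m d : ℕ} (hd : 1 ≤ d) {a : Fin (m + 2) →₀ ℕ} :
    (a = Finsupp.single 0 1 + Finsupp.single 1 (d - 1) ∨
        RevLexGT a (Finsupp.single 0 1 + Finsupp.single 1 (d - 1))) ↔
      ∃ s t : ℕ, s + 1 + t = d ∧ a = Finsupp.single 0 (s + 1) + Finsupp.single 1 t := by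
  constructor
  · rintro (rfl | h)
    · exact ⟨0, d - 1, by omega, rfl⟩
    · exact h.exists_eq_single_add_single hd
  · rintro ⟨_ | s, t, rfl, rfl⟩
    · left
      simp
    · refine Or.inr ⟨?_, 1, ?_, fun j hj => ?_⟩
      · simp only [map_add, Finsupp.degree_single]
        omega
      · simp
      · have hj0 : j ≠ 0 := (Fin.zero_lt_one.trans hj).ne'
        simp [Finsupp.single_eq_of_ne hj0, Finsupp.single_eq_of_ne hj.ne']

theorem RLex_single_add_single {k : Type*} [Field k] {m d : ℕ} (hd : 1 ≤ d) :
    RLex k (Finsupp.single (0 : Fin (m + 2)) 1 + Finsupp.single 1 (d - 1)) =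
      Ideal.span {f | ∃ s t : ℕ, s + 1 + t = d ∧ f = X 0 ^ (s + 1) * X 1 ^ t} := by
  simp only [RLex, eq_or_revLexGT_single_add_single_iff hd, X_pow_eq_monomial, monomial_mul,
    one_mul]
  congr 1
  ext f
  constructor
  · rintro ⟨_, ⟨s, t, hst, rfl⟩, rfl⟩
    exact ⟨s, t, hst, rfl⟩
  · rintro ⟨s, t, hst, rfl⟩
    exact ⟨_, ⟨s, t, hst, rfl⟩, rfl⟩

theorem purePowers_add_RLex_eq_pairPowIdeal {k : Type*} [Field k] {m d : ℕ} (hd : 1 ≤ d) :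
    purePowers k (Fin (m + 2)) d +
        RLex k (Finsupp.single (0 : Fin (m + 2)) 1 + Finsupp.single 1 (d - 1)) =
      pairPowIdeal k d m := by
  rw [RLex_single_add_single hd, purePowers, Ideal.add_eq_sup]
  refine le_antisymm (sup_le (Ideal.span_le.2 ?_) (Ideal.span_le.2 ?_))
    (pairPowIdeal_le_iff.2 ⟨?_, fun i => ?_⟩)
  · rintro _ ⟨i, rfl⟩
    refine Fin.cases ?_ (Fin.cases ?_ X_succ_succ_pow_mem_pairPowIdeal) i
    · simpa using X_pow_mul_X_pow_mem_pairPowIdeal (R := k) (m := m) (add_zero d)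
    · simpa using X_pow_mul_X_pow_mem_pairPowIdeal (R := k) (m := m) (zero_add d)
  · rintro _ ⟨s, t, hst, rfl⟩
    exact X_pow_mul_X_pow_mem_pairPowIdeal hst
  · rintro (_ | s) t hst
    · exact Ideal.mem_sup_left (Ideal.subset_span ⟨1, by simp [← hst]⟩)
    · exact Ideal.mem_sup_right (Ideal.subset_span ⟨s, t, hst, rfl⟩)
  · exact Ideal.mem_sup_left (Ideal.subset_span ⟨_, rfl⟩)

end PairPowIdeal

section PairSubstitution

variable {R : Type*} [CommSemiring R] {m : ℕ}

/-- The substitution `x_0 ↦ q_0 x_0 + q_1 x_1`, `x_{i+1} ↦ x_{i+2}`. -/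
noncomputable def embedPair (q : Fin 2 → R) :
    MvPolynomial (Fin (m + 1)) R →ₐ[R] MvPolynomial (Fin (m + 2)) R :=
  aeval (Fin.cons (C (q 0) * X 0 + C (q 1) * X 1) fun i => X i.succ.succ)

/-- The substitution `x_0 ↦ p_0 x_0`, `x_1 ↦ p_1 x_0`, `x_{i+2} ↦ x_{i+1}`; it retracts
`embedPair q` when `q_0 p_0 + q_1 p_1 = 1`. -/
noncomputable def collapsePair (p : Fin 2 → R) :
    MvPolynomial (Fin (m + 2)) R →ₐ[R] MvPolynomial (Fin (m + 1)) R :=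
  aeval (Fin.cons (C (p 0) * X 0) (Fin.cons (C (p 1) * X 0) fun i => X i.succ))

@[simp]
theorem embedPair_X_zero (q : Fin 2 → R) :
    embedPair (m := m) q (X 0) = C (q 0) * X 0 + C (q 1) * X 1 := by
  simp [embedPair]

@[simp]
theorem embedPair_X_succ (q : Fin 2 → R) (i : Fin m) : embedPair q (X i.succ) = X i.succ.succ := by
  simp [embedPair]

@[simp]
theorem collapsePair_X_zero (p : Fin 2 → R) :
    collapsePair (m := m) p (X 0) = C (p 0) * X 0 := by
  simp [collapsePair]

@[simp]
theorem collapsePair_X_one (p : Fin 2 → R) :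
    collapsePair (m := m) p (X 1) = C (p 1) * X 0 := by
  rw [collapsePair, aeval_X, show (1 : Fin (m + 2)) = Fin.succ 0 from rfl, Fin.cons_succ,
    Fin.cons_zero]

@[simp]
theorem collapsePair_X_succ_succ (p : Fin 2 → R) (i : Fin m) :
    collapsePair p (X i.succ.succ) = X i.succ := by
  simp [collapsePair]

theorem embedPair_X_isHomogeneous (q : Fin 2 → R) (i : Fin (m + 1)) :
    (embedPair q (X i)).IsHomogeneous 1 := by
  cases i using Fin.cases with
  | zero =>
    rw [embedPair_X_zero]
    exact (isHomogeneous_C_mul_X _ _).add (isHomogeneous_C_mul_X _ _)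
  | succ i =>
    rw [embedPair_X_succ]
    exact isHomogeneous_X _ _

theorem collapsePair_X_isHomogeneous (p : Fin 2 → R) (i : Fin (m + 2)) :
    (collapsePair p (X i)).IsHomogeneous 1 := by
  rw [collapsePair, aeval_X]
  cases i using Fin.cases with
  | zero => exact isHomogeneous_C_mul_X _ _
  | succ i =>
    cases i using Fin.cases with
    | zero => exact isHomogeneous_C_mul_X _ _
    | succ i => exact isHomogeneous_X _ _

theorem embedPair_rename_succ (q : Fin 2 → R) (f : MvPolynomial (Fin m) R) :
    embedPair q (rename Fin.succ f) = rename Fin.succ (rename Fin.succ f) := by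
  induction f using MvPolynomial.induction_on with
  | C a => simp
  | add f g hf hg => simp only [map_add, hf, hg]
  | mul_X f i hf => simp only [map_mul, rename_X, embedPair_X_succ, hf]

theorem collapsePair_rename_succ_rename_succ (p : Fin 2 → R) (f : MvPolynomial (Fin m) R) :
    collapsePair p (rename Fin.succ (rename Fin.succ f)) = rename Fin.succ f := by
  induction f using MvPolynomial.induction_on with
  | C a => simp
  | add f g hf hg => simp only [map_add, hf, hg]
  | mul_X f i hf => simp only [map_mul, rename_X, collapsePair_X_succ_succ, hf]

theorem collapsePair_embedPair {p q : Fin 2 → R} (h : q ⬝ᵥ p = 1) :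
    Function.LeftInverse (collapsePair (m := m) p) (embedPair q) := by
  rw [dotProduct, Fin.sum_univ_two] at h
  suffices (collapsePair (m := m) p).comp (embedPair q) = AlgHom.id R _ from
    fun f => DFunLike.congr_fun this f
  ext1 i
  cases i using Fin.cases with
  | zero =>
    simp only [AlgHom.comp_apply, embedPair_X_zero, map_add, map_mul, algHom_C, algebraMap_eq,
      collapsePair_X_zero, collapsePair_X_one, AlgHom.id_apply]
    rw [← mul_assoc, ← mul_assoc, ← add_mul, ← C_mul, ← C_mul, ← C_add, h, C_1, one_mul]
  | succ i => simp

theorem purePowers_le_comap_embedPair (q : Fin 2 → R) (d : ℕ) :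
    purePowers R (Fin (m + 1)) d ≤ (pairPowIdeal R d m).comap (embedPair q) := by
  refine Ideal.span_le.2 ?_
  rintro _ ⟨i, rfl⟩
  rw [SetLike.mem_coe, Ideal.mem_comap, map_pow]
  cases i using Fin.cases with
  | zero =>
    rw [embedPair_X_zero]
    exact Ideal.mem_sup_left (Ideal.pow_mem_pow (Ideal.add_mem _
      (Ideal.mul_mem_left _ _ (Ideal.subset_span (by simp)))
      (Ideal.mul_mem_left _ _ (Ideal.subset_span (by simp)))) d)
  | succ i =>
    rw [embedPair_X_succ]
    exact X_succ_succ_pow_mem_pairPowIdeal i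

theorem pairPowIdeal_le_comap_collapsePair (p : Fin 2 → R) (d : ℕ) :
    pairPowIdeal R d m ≤ (purePowers R (Fin (m + 1)) d).comap (collapsePair p) := by
  refine pairPowIdeal_le_iff.2 ⟨fun s t hst => ?_, fun i => ?_⟩
  · have collapse_eq : collapsePair (m := m) p (X 0 ^ s * X 1 ^ t) =
        (C (p 0) ^ s * C (p 1) ^ t) * X 0 ^ d := by
      simp only [map_mul, map_pow, collapsePair_X_zero, collapsePair_X_one, ← hst]
      ring
    rw [Ideal.mem_comap, collapse_eq]
    exact Ideal.mul_mem_left _ _ (X_pow_mem_purePowers d 0)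
  · rw [Ideal.mem_comap, map_pow, collapsePair_X_succ_succ]
    exact X_pow_mem_purePowers d _

theorem comap_embedPair_pairPowIdeal {p q : Fin 2 → R} (h : q ⬝ᵥ p = 1) (d : ℕ) :
    (pairPowIdeal R d m).comap (embedPair q) = purePowers R (Fin (m + 1)) d := by
  refine le_antisymm (fun f hf => ?_) (purePowers_le_comap_embedPair q d)
  rw [← collapsePair_embedPair h f]
  exact pairPowIdeal_le_comap_collapsePair p d hf

end PairSubstitution

section LinearForms

theorem exists_eq_C_mul_X_zero_add_rename_succ {R : Type*} [CommSemiring R] {n : ℕ}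
    {L : MvPolynomial (Fin (n + 1)) R} (hL : L.IsHomogeneous 1) :
    ∃ (c : R) (M : MvPolynomial (Fin n) R),
      M.IsHomogeneous 1 ∧ L = C c * X 0 + rename Fin.succ M := by
  have hspan : L ∈ homogeneousSubmodule (Fin (n + 1)) R 1 := hL
  rw [homogeneousSubmodule_one_eq_span_X, Submodule.mem_span_range_iff_exists_fun] at hspan
  obtain ⟨c, rfl⟩ := hspan
  refine ⟨c 0, ∑ i, C (c i.succ) * X i,
    IsHomogeneous.sum _ _ _ fun i _ => isHomogeneous_C_mul_X _ _, ?_⟩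
  simp [Fin.sum_univ_succ, smul_eq_C_mul]

theorem exists_smul_eq_and_dotProduct_eq_one {k ι : Type*} [Field k] [Fintype ι] [Nonempty ι]
    (c : ι → k) : ∃ (s : k) (q p : ι → k), s • q = c ∧ q ⬝ᵥ p = 1 := by
  classical
  by_cases hc : c = 0
  · obtain ⟨i⟩ := ‹Nonempty ι›
    exact ⟨0, Pi.single i 1, Pi.single i 1, by simp [hc], by simp⟩
  · obtain ⟨i, hi⟩ := Function.ne_iff.1 hc
    exact ⟨1, c, Pi.single i (c i)⁻¹, one_smul _ _, by simp [mul_inv_cancel₀ hi]⟩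

theorem exists_dotProduct_eq_zero_and_dotProduct_eq_one {k ι : Type*} [Field k] [Fintype ι]
    [Nontrivial ι] (c : ι → k) : ∃ p q : ι → k, c ⬝ᵥ p = 0 ∧ q ⬝ᵥ p = 1 := by
  classical
  obtain ⟨i, j, hij⟩ := exists_pair_ne ι
  by_cases hi : c i = 0
  · exact ⟨Pi.single i 1, Pi.single i 1, by simp [hi], by simp⟩
  · refine ⟨Pi.single j (c i) - Pi.single i (c j), Pi.single j (c i)⁻¹, ?_, ?_⟩
    · simp [dotProduct_sub, mul_comm]
    · simp [hij.symm, hi]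

variable {k : Type*} [Field k] {m : ℕ} {L : MvPolynomial (Fin (m + 2)) k}

theorem exists_embedPair_eq (hL : L.IsHomogeneous 1) :
    ∃ (q p : Fin 2 → k) (M : MvPolynomial (Fin (m + 1)) k),
      q ⬝ᵥ p = 1 ∧ M.IsHomogeneous 1 ∧ embedPair q M = L := by
  obtain ⟨c₀, L', hL', rfl⟩ := exists_eq_C_mul_X_zero_add_rename_succ hL
  obtain ⟨c₁, M, hM, rfl⟩ := exists_eq_C_mul_X_zero_add_rename_succ hL'
  obtain ⟨s, q, p, hsq, hqp⟩ := exists_smul_eq_and_dotProduct_eq_one ![c₀, c₁]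
  have h₀ : s * q 0 = c₀ := congrFun hsq 0
  have h₁ : s * q 1 = c₁ := congrFun hsq 1
  refine ⟨q, p, C s * X 0 + rename Fin.succ M, hqp,
    (isHomogeneous_C_mul_X _ _).add hM.rename_isHomogeneous, ?_⟩
  simp only [map_add, map_mul, algHom_C, algebraMap_eq, embedPair_X_zero, embedPair_rename_succ,
    rename_X, Fin.succ_zero_eq_one, ← h₀, ← h₁]
  ring

theorem exists_collapsePair_eq_rename_succ (hL : L.IsHomogeneous 1) :
    ∃ (p q : Fin 2 → k) (M : MvPolynomial (Fin m) k),
      q ⬝ᵥ p = 1 ∧ M.IsHomogeneous 1 ∧ collapsePair p L = rename Fin.succ M := by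
  obtain ⟨c₀, L', hL', rfl⟩ := exists_eq_C_mul_X_zero_add_rename_succ hL
  obtain ⟨c₁, M, hM, rfl⟩ := exists_eq_C_mul_X_zero_add_rename_succ hL'
  obtain ⟨p, q, hcp, hqp⟩ := exists_dotProduct_eq_zero_and_dotProduct_eq_one ![c₀, c₁]
  have hcp' : c₀ * p 0 + c₁ * p 1 = 0 := by simpa [dotProduct, Fin.sum_univ_two] using hcp
  refine ⟨p, q, M, hqp, hM, ?_⟩
  simp only [map_add, map_mul, algHom_C, algebraMap_eq, rename_X, Fin.succ_zero_eq_one,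
    collapsePair_X_zero, collapsePair_X_one, collapsePair_rename_succ_rename_succ]
  rw [← add_assoc, ← mul_assoc, ← mul_assoc, ← add_mul, ← C_mul, ← C_mul, ← C_add, hcp', C_0,
    zero_mul, zero_add]

end LinearForms

section WeakLefschetz

variable {k : Type*} [Field k] {d m : ℕ}

theorem not_injective_mulLinearForm_pairPowIdeal {j : ℕ}
    (h : boxCount d (m + 1) (j + 1) < boxCount d (m + 1) j)
    (l : gradedPart (pairPowIdeal k d m) 1) :
    ¬ Function.Injective (mulLinearForm (pairPowIdeal k d m) l j) := by
  intro hinj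
  obtain ⟨_, L, hL, rfl⟩ := l
  obtain ⟨q, p, M, hqp, hM, rfl⟩ := exists_embedPair_eq hL
  refine h.not_ge ?_
  rw [← Nat.cast_succ, ← finrank_gradedPart_purePowers (k := k),
    ← finrank_gradedPart_purePowers (k := k)]
  exact LinearMap.finrank_le_finrank_of_injective (mulLinearForm_injective_of_comap_eq
    (embedPair_X_isHomogeneous q) (comap_embedPair_pairPowIdeal hqp d) hM hinj)

theorem not_surjective_mulLinearForm_pairPowIdeal {e : ℕ} (hd : 1 ≤ d)
    (h : boxCount d m e < boxCount d m (e + 1)) (l : gradedPart (pairPowIdeal k d m) 1) :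
    ¬ Function.Surjective (mulLinearForm (pairPowIdeal k d m) l (e + (d - 1))) := by
  intro hsurj
  obtain ⟨_, L, hL, rfl⟩ := l
  obtain ⟨p, q, M, hqp, hM, hLM⟩ := exists_collapsePair_eq_rename_succ hL
  have hsurj' := mulLinearForm_surjective_of_le_comap (collapsePair_X_isHomogeneous p)
    (collapsePair_embedPair hqp).surjective (pairPowIdeal_le_comap_collapsePair p d) hL hsurj
  simp only [hLM] at hsurj'
  refine h.not_ge ?_
  rw [← Nat.cast_succ, ← finrank_gradedPart_purePowers (k := k),
    ← finrank_gradedPart_purePowers (k := k)]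
  exact LinearMap.finrank_le_finrank_of_surjective
    (mulLinearForm_surjective_of_rename_succ (Nat.sub_one_lt_of_le hd le_rfl) hM hsurj')

theorem exists_degree_between_middles (hd : 3 ≤ d) (hm : 1 ≤ m) :
    ∃ e : ℕ, (m + 1) * ((d : ℤ) - 1) ≤ 2 * (e + ((d : ℤ) - 1)) ∧
      2 * ((e : ℤ) + 1) ≤ m * ((d : ℤ) - 1) := by
  obtain ⟨c, rfl⟩ := Nat.exists_eq_add_of_le' (show 1 ≤ d by omega)
  obtain ⟨r, rfl⟩ := Nat.exists_eq_add_of_le' hm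
  refine ⟨(r * c + 1) / 2, ?_⟩
  push_cast
  rw [add_sub_cancel_right, add_mul, add_mul, one_mul]
  rcases (show 2 ≤ c by omega).eq_or_lt with rfl | hc
  · omega
  · generalize (r : ℤ) * c = z
    omega

theorem not_hasWLP_pairPowIdeal (hd : 3 ≤ d) (hm : 2 ≤ m) : ¬ HasWLP (pairPowIdeal k d m) := by
  rintro ⟨l, hl⟩
  obtain ⟨e, hlow, hhigh⟩ := exists_degree_between_middles hd (m := m) (by omega)
  have hcast : ((e + (d - 1) : ℕ) : ℤ) = e + ((d : ℤ) - 1) := by omega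
  have hgrow : boxCount d m e < boxCount d m (e + 1) :=
    boxCount_strictMonoOn (by omega) hm ⟨by omega, by omega⟩ ⟨by omega, hhigh⟩ (by omega)
  have hshrink :
      boxCount d (m + 1) ((e + (d - 1) : ℕ) + 1) < boxCount d (m + 1) (e + (d - 1) : ℕ) := by
    refine boxCount_strictAntiOn (by omega) (by omega) ?_ ?_ (by omega)
    all_goals
      rw [hcast]
      push_cast
      constructor <;> linarith
  rcases (hl (e + (d - 1))).injective_or_surjective with hinj | hsurj
  · exact not_injective_mulLinearForm_pairPowIdeal hshrink l hinj
  · exact not_surjective_mulLinearForm_pairPowIdeal (by omega) hgrow l hsurj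

end WeakLefschetz

theorem mainTheorem6_general {k : Type*} [Field k] (m d : ℕ) (hm : 2 ≤ m) (hd : 3 ≤ d)
    (I : Ideal (MvPolynomial (Fin (m + 2)) k))
    (hI : I = Ideal.span (Set.range fun i : Fin (m + 2) => (X i : MvPolynomial (Fin (m + 2)) k) ^ d)
      + RLex k (Finsupp.single (0 : Fin (m + 2)) 1 + Finsupp.single 1 (d - 1))) :
    I = Ideal.span {X 0, X 1} ^ d
        + Ideal.span {f | ∃ i : Fin (m + 2), 2 ≤ (i : ℕ) ∧ f = X i ^ d} ∧
      ¬ HasWLP I := by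
  obtain rfl : I = pairPowIdeal k d m := hI.trans (purePowers_add_RLex_eq_pairPowIdeal (by omega))
  exact ⟨rfl, not_hasWLP_pairPowIdeal hd hm⟩

theorem mainTheorem6 {k : Type*} [Field k] [CharZero k] (n d : ℕ) (hn : 4 ≤ n) (hd : 3 ≤ d)
    (I : Ideal (MvPolynomial (Fin n) k))
    (hI : I = Ideal.span (Set.range fun i : Fin n => (MvPolynomial.X i : MvPolynomial (Fin n) k) ^ d)
      + RLex k (Finsupp.single (⟨0, by omega⟩ : Fin n) 1
          + Finsupp.single (⟨1, by omega⟩ : Fin n) (d - 1))) :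
    I = Ideal.span {MvPolynomial.X (⟨0, by omega⟩ : Fin n),
            MvPolynomial.X (⟨1, by omega⟩ : Fin n)} ^ d
        + Ideal.span {f | ∃ i : Fin n, 2 ≤ (i : ℕ) ∧ f = MvPolynomial.X i ^ d} ∧
      ¬ HasWLP I := by
  obtain ⟨m, rfl⟩ := Nat.exists_eq_add_of_le' (show 2 ≤ n by omega)
  exact mainTheorem6_general m d (by omega) hd I hI
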